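/- **Theorem (Mellin and Fourier).** Let $g:(0,\infty)\to\mathbb C$ be smooth with compact support in $(0,\infty)$, extended by $g(0)=0$, and let $\widehat g(s)=\int_0^\infty g(u)\,u^{s}\,\frac{du}{u}$ be its Mellin transform. Let $\mathbb Q_\nu$ be a completion of $\mathbb Q$, that is, $\mathbb R$ (written $\nu=r$) or $\mathbb Q_p$ for a prime $p$ (written $\nu=p$), with its usual absolute value $|\cdot|_\nu$ (so $|p|_p=1/p$). Let $dy$ be Lebesgue measure on $\mathbb R$, respectively the Haar measure on $\mathbb Q_p$ with $\mathrm{vol}(\mathbb Z_p)=1$. Let $\psi_r(x)=e^{2\pi i x}$ on $\mathbb R$ and $\psi_p(x)=e^{-2\pi i\{x\}_p}$ on $\mathbb Q_p$, where $\{x\}_p\in\mathbb Z[1/p]\cap[0,1)$ is the $p$-adic fractional part, $x-\{x\}_p\in\mathbb Z_p$. For integrable $f:\mathbb Q_\nu\to\mathbb C$ put $\mathcal F^{-1}(f)(x)=\int_{\mathbb Q_\nu} f(y)\,\psi_\nu(xy)\,dy$. Let $$\Gamma_p(s)=\frac{1-p^{-1+s}}{1-p^{-s}},\qquad \Gamma_r(s)=\pi^{\frac12-s}\,\frac{\Gamma(s/2)}{\Gamma((1-s)/2)},$$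 and $g_\nu(y)=g(|y|_\nu)$ for $y\in\mathbb Q_\nu$. Then, for every place $\nu$ of $\mathbb Q$ and every real $c$ with $0<c<1$, the function $g_\nu$ is integrable on $\mathbb Q_\nu$, and for every $x\in\mathbb Q_\nu$ with $x\neq0$ the integral on the right-hand side below converges absolutely and $$\mathcal F^{-1}(g_\nu)(x)=\frac1{2\pi i}\int_{\mathrm{Re}(s)=c}\widehat g(s)\,\frac{|x|_\nu^{\,s-1}}{\Gamma_\nu(s)}\,ds .$$ -/

import Mathlib

open Complex MeasureTheory
open scoped ContDiff FourierTransform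

noncomputable section

namespace MellinFourier

/-! ### The field `ℚ_p`: Borel structure, normalized Haar measure, standard character -/

instance padicMeasurableSpace (p : ℕ) [Fact p.Prime] : MeasurableSpace ℚ_[p] := borel ℚ_[p]

instance padicBorelSpace (p : ℕ) [Fact p.Prime] : BorelSpace ℚ_[p] := ⟨rfl⟩

/-- The compact subring `ℤ_p = {x : |x|_p ≤ 1}` of `ℚ_p`. -/
def padicIntegersCompacts (p : ℕ) [Fact p.Prime] :
    TopologicalSpace.PositiveCompacts ℚ_[p] where
  carrier := Metric.closedBall 0 1
  isCompact' := isCompact_closedBall 0 1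
  interior_nonempty' :=
    ⟨0, Metric.ball_subset_interior_closedBall (Metric.mem_ball_self one_pos)⟩

/-- The additive Haar measure on `ℚ_p` that gives `ℤ_p` volume `1`. -/
def padicHaar (p : ℕ) [Fact p.Prime] : Measure ℚ_[p] :=
  Measure.addHaarMeasure (padicIntegersCompacts p)

/-- With `n = max(0, -v_p(x))`, the element `p ^ n * x` lies in `ℤ_p`. -/
theorem norm_mul_pow_le_one {p : ℕ} [Fact p.Prime] (x : ℚ_[p]) :
    ‖x * (p : ℚ_[p]) ^ (-x.valuation).toNat‖ ≤ 1 := by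
  have hp1 : (1 : ℝ) < p := by exact_mod_cast (Fact.out : p.Prime).one_lt
  by_cases hx : x = 0
  · simp [hx]
  · rw [norm_mul, Padic.norm_p_pow, Padic.norm_eq_zpow_neg_valuation hx,
      ← zpow_add₀ (by positivity)]
    apply zpow_le_one_of_nonpos₀ hp1.le
    omega

/-- The element `p ^ n * x` of `ℤ_p`, where `n = max(0, -v_p(x))`. -/
def padicNumerator {p : ℕ} [Fact p.Prime] (x : ℚ_[p]) : ℤ_[p] :=
  ⟨x * (p : ℚ_[p]) ^ (-x.valuation).toNat, norm_mul_pow_le_one x⟩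

/-- The fractional part `{x}_p`, as a rational number: with `n = max(0, -v_p(x))`, it is
`a / p ^ n`, where `0 ≤ a < p ^ n` is the integer congruent to `p ^ n * x` modulo `p ^ n ℤ_p`. -/
def padicFract {p : ℕ} [Fact p.Prime] (x : ℚ_[p]) : ℚ :=
  (PadicInt.appr (padicNumerator x) (-x.valuation).toNat : ℚ) / (p : ℚ) ^ (-x.valuation).toNat

theorem norm_sub_padicFract_le_one {p : ℕ} [Fact p.Prime] (x : ℚ_[p]) :
    ‖x - (padicFract x : ℚ_[p])‖ ≤ 1 := by
  have hp0 : (0 : ℝ) < p := by exact_mod_cast (Fact.out : p.Prime).pos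
  have hpQ : (p : ℚ_[p]) ≠ 0 := by exact_mod_cast (Fact.out : p.Prime).ne_zero
  suffices H : ∀ (n : ℕ) (z : ℤ_[p]), (z : ℚ_[p]) = x * (p : ℚ_[p]) ^ n →
      ‖x - ((((PadicInt.appr z n : ℚ) / (p : ℚ) ^ n : ℚ)) : ℚ_[p])‖ ≤ 1 from
    H _ (padicNumerator x) rfl
  intro n z hz
  have h := PadicInt.appr_spec n z
  rw [← PadicInt.norm_le_pow_iff_mem_span_pow, PadicInt.norm_def] at h
  generalize PadicInt.appr z n = a at h ⊢
  have e : x - ((((a : ℚ) / (p : ℚ) ^ n : ℚ)) : ℚ_[p])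
      = (x * (p : ℚ_[p]) ^ n - a) * ((p : ℚ_[p]) ^ n)⁻¹ := by
    push_cast
    field_simp
  rw [PadicInt.coe_sub, PadicInt.coe_natCast, hz] at h
  rw [e, norm_mul, norm_inv, Padic.norm_p_pow]
  rw [zpow_neg, inv_inv]
  calc ‖x * (p : ℚ_[p]) ^ n - a‖ * (p : ℝ) ^ (n : ℤ)
      ≤ (p : ℝ) ^ (-(n : ℤ)) * (p : ℝ) ^ (n : ℤ) := by
        gcongr
    _ = 1 := by rw [← zpow_add₀ hp0.ne']; simp

/-- A rational number with `p`-power denominator which is a `p`-adic integer is an integer. -/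
theorem exists_int_of_norm_le_one {p : ℕ} [Fact p.Prime] (q : ℚ) (n : ℕ) (m : ℤ)
    (hq : q * (p : ℚ) ^ n = m) (h : ‖(q : ℚ_[p])‖ ≤ 1) : ∃ k : ℤ, q = k := by
  have hpQ : (p : ℚ) ≠ 0 := by exact_mod_cast (Fact.out : p.Prime).ne_zero
  have hp0 : (0 : ℝ) < p := by exact_mod_cast (Fact.out : p.Prime).pos
  have h1 : ‖((m : ℤ) : ℚ_[p])‖ ≤ (p : ℝ) ^ (-(n : ℤ)) := by
    have : ((m : ℤ) : ℚ_[p]) = (q : ℚ_[p]) * (p : ℚ_[p]) ^ n := by exact_mod_cast hq.symm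
    rw [this, norm_mul, Padic.norm_p_pow]
    exact mul_le_of_le_one_left (by positivity) h
  rw [Padic.norm_int_le_pow_iff_dvd] at h1
  obtain ⟨k, hk⟩ := h1
  refine ⟨k, mul_right_cancel₀ (pow_ne_zero n hpQ) ?_⟩
  rw [hq, hk]
  push_cast
  ring

theorem padicFract_add {p : ℕ} [Fact p.Prime] (x y : ℚ_[p]) :
    ∃ k : ℤ, padicFract (x + y) = padicFract x + padicFract y + k := by
  have hpQ : (p : ℚ) ≠ 0 := by exact_mod_cast (Fact.out : p.Prime).ne_zero
  have key : ∀ z : ℚ_[p], ∃ (n : ℕ) (a : ℤ), padicFract z * (p : ℚ) ^ n = a := fun z =>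
    ⟨_, (PadicInt.appr _ _ : ℤ), by
      unfold padicFract
      rw [div_mul_cancel₀ _ (pow_ne_zero _ hpQ)]
      norm_cast⟩
  obtain ⟨n₁, a₁, h₁⟩ := key (x + y)
  obtain ⟨n₂, a₂, h₂⟩ := key x
  obtain ⟨n₃, a₃, h₃⟩ := key y
  have := exists_int_of_norm_le_one (p := p)
    (padicFract (x + y) - (padicFract x + padicFract y)) (n₁ + n₂ + n₃)
    (a₁ * p ^ (n₂ + n₃) - (a₂ * p ^ (n₁ + n₃) + a₃ * p ^ (n₁ + n₂))) (by
      push_cast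
      rw [← h₁, ← h₂, ← h₃]
      ring) (by
      have e : ((padicFract (x + y) - (padicFract x + padicFract y) : ℚ) : ℚ_[p])
          = ((x - (padicFract x : ℚ_[p])) + (y - (padicFract y : ℚ_[p])))
            - ((x + y) - (padicFract (x + y) : ℚ_[p])) := by
        push_cast
        ring
      rw [e]
      have h3 := norm_sub_padicFract_le_one (x + y)
      rw [← norm_neg] at h3
      rw [sub_eq_add_neg]
      exact (IsUltrametricDist.norm_add_le_max _ _).trans (max_le
        ((IsUltrametricDist.norm_add_le_max _ _).trans
          (max_le (norm_sub_padicFract_le_one x) (norm_sub_padicFract_le_one y))) h3))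
  obtain ⟨k, hk⟩ := this
  exact ⟨k, by linarith⟩

theorem padicFract_zero {p : ℕ} [Fact p.Prime] : padicFract (0 : ℚ_[p]) = 0 := by
  simp [padicFract, PadicInt.appr]

/-- The standard additive character `ψ_p(x) = exp(-2πi {x}_p)` of `ℚ_p`; together with
`exp(2πi x)` on `ℝ` it makes up the character of the adeles that is trivial on `ℚ`. -/
def padicChar (p : ℕ) [Fact p.Prime] : AddChar ℚ_[p] Circle where
  toFun x := Circle.exp (-(2 * Real.pi * (padicFract x : ℝ)))
  map_zero_eq_one' := by simp [padicFract_zero]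
  map_add_eq_mul' x y := by
    obtain ⟨k, hk⟩ := padicFract_add x y
    rw [← Circle.exp_add, hk]
    have : -(2 * Real.pi * ((padicFract x + padicFract y + k : ℚ) : ℝ))
        = (-(2 * Real.pi * (padicFract x : ℝ)) + -(2 * Real.pi * (padicFract y : ℝ)))
          - k * (2 * Real.pi) := by
      push_cast
      ring
    rw [this]
    exact Circle.periodic_exp.sub_int_mul_eq k

/-- The inverse Fourier transform on `ℚ_p`, `(𝓕⁻¹ f)(x) = ∫ f(y) ψ_p(x y) dy`
(for the self-dual measure `dy`). -/
def padicFourierInv {p : ℕ} [Fact p.Prime] (f : ℚ_[p] → ℂ) (x : ℚ_[p]) : ℂ :=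
  ∫ y, (padicChar p (x * y) : ℂ) * f y ∂(padicHaar p)

/-! ### Gamma factors and line integrals -/

/-- The Gamma factor `Γ_r(s) = π^(1/2 - s) Γ(s/2) / Γ((1 - s)/2)` of the real place. -/
def tateGammaReal (s : ℂ) : ℂ :=
  (Real.pi : ℂ) ^ (1 / 2 - s) * (Complex.Gamma (s / 2) / Complex.Gamma ((1 - s) / 2))

/-- The Gamma factor `Γ_p(s) = (1 - p^(-1 + s)) / (1 - p^(-s))` of the place `p`. -/
def tateGammaPadic (p : ℕ) (s : ℂ) : ℂ :=
  (1 - (p : ℂ) ^ (-1 + s)) / (1 - (p : ℂ) ^ (-s))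

/-- The integral of `F` over the line `Re s = c`, upwards: `s = c + i t`, `ds = i dt`. -/
def lineIntegral (c : ℝ) (F : ℂ → ℂ) : ℂ :=
  ∫ t : ℝ, F (c + t * I) * I

end MellinFourier

end

/-!
Both formulas are Mellin inversion combined with Tate's local functional equation; the two kinds of
places are reached by different routes.

At the real place, `φ(y) = g(|y|)` is an even Schwartz function, because `g(|y|) = g(y) + g(-y)`.
Testing `𝓕 φ` against the Gaussians `exp(-π t x²)` and using that the Fourier transform is
self-adjoint gives `G(𝓕 φ)(t) = t^(-1/2) G(φ)(1/t)`, where `G` is the Gaussian transform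
(`gaussTransform_fourier`). By Fubini the Mellin transform of `G(f)` at `w` is
`π^(-w) Γ(w)` times that of `f` at `1 - 2w` (`mellin_gaussTransform`); taking `w = s/2` yields the
functional equation `mellin (𝓕 φ) (1 - s) = mellin g s / Γ_r(s)` for `0 < Re s < 1`, with all the
integrals absolutely convergent. The claim is then Mellin inversion for `𝓕 φ` on the line
`Re s = 1 - c`. The absolute convergence it needs holds because a Mellin transform along a vertical
line is the Fourier transform of `u ↦ exp(-σ u) f(exp(-u))`, which for Schwartz `f` and `σ > 0` has
integrable derivatives of all orders.

At a prime `p`, put `|x| = p^n`. The function `g(|y|)` is a finite combination of indicator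
functions of the balls `|y| ≤ p^m` with coefficients `g(p^m) - g(p^(m+1))`. The character
`y ↦ ψ_p(x y)` integrates over such a ball to its volume `p^m` if `m ≤ -n`, and to `0` otherwise, by
orthogonality. Hence the Fourier transform at `x` is the sum of `p^m (g(p^m) - g(p^(m+1)))` over
`m ≤ -n` (`hasSum_padicFourierInv_radial`). On the other side `1 / Γ_p(s)` is a geometric series in
`p^(s-1)` when `Re s < 1` (`hasSum_div_tateGammaPadic`), and integrating it term by term with Mellin
inversion for `g` produces the same sum.
-/

noncomputable section

namespace MellinFourier

open Set Filter Asymptotics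
open scoped Topology SchwartzMap

/-! ### Mellin transforms of Schwartz functions -/

theorem mellinConvergent_schwartz (f : 𝓢(ℝ, ℂ)) {s : ℂ} (hs : 0 < s.re) :
    MellinConvergent f s := by
  refine mellinConvergent_of_isBigO_rpow (a := s.re + 1) (b := 0)
    (f.continuous.locallyIntegrable.locallyIntegrableOn _) ?_ (by linarith) ?_ hs
  · have h := (f.isBigO_cocompact_rpow (-(s.re + 1))).mono atTop_le_cocompact
    refine h.trans (IsBigO.of_bound 1 ?_)
    filter_upwards [eventually_ge_atTop 0] with x hx
    simp [abs_of_nonneg hx]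
  · simp only [neg_zero, Real.rpow_zero]
    exact (f.continuous.tendsto 0).isBigO_one ℝ |>.mono nhdsWithin_le_nhds

/-- The function `u ↦ exp(-σ u) f(exp(-u))` on `ℝ`, whose Fourier transform at `t / 2π` is the Mellin
transform of `f` at `σ + i t`. -/
def mellinPullback (σ : ℝ) (f : ℝ → ℂ) (u : ℝ) : ℂ :=
  Real.exp (-σ * u) • f (Real.exp (-u))

theorem integrable_mellinPullback {σ : ℝ} {f : ℝ → ℂ} (hf : MellinConvergent f σ) :
    Integrable (mellinPullback σ f) := by
  have hd : ∀ x ∈ univ, HasDerivWithinAt (fun u : ℝ => Real.exp (-u)) (-Real.exp (-x)) univ x := by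
    intro x _
    exact ((hasDerivAt_neg x).exp.congr_deriv (by simp)).hasDerivWithinAt
  have hi : InjOn (fun u : ℝ => Real.exp (-u)) univ :=
    (Real.exp_injective.comp neg_injective).injOn
  have him : (fun u : ℝ => Real.exp (-u)) '' univ = Ioi 0 := by
    ext y
    simp only [image_univ, mem_range, mem_Ioi]
    exact ⟨fun ⟨u, hu⟩ => hu ▸ Real.exp_pos _, fun hy => ⟨-Real.log y, by simp [Real.exp_log hy]⟩⟩
  rw [MellinConvergent, ← him,
    integrableOn_image_iff_integrableOn_abs_deriv_smul MeasurableSet.univ hd hi,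
    integrableOn_univ] at hf
  refine hf.congr (Eventually.of_forall fun u => ?_)
  have h0 : (Real.exp (-u) : ℂ) ≠ 0 := by exact_mod_cast (Real.exp_pos _).ne'
  simp only [mellinPullback, abs_neg, Real.abs_exp, real_smul, smul_eq_mul]
  rw [cpow_sub _ _ h0, cpow_one, ← mul_assoc, mul_div_cancel₀ _ h0, ← ofReal_cpow (Real.exp_pos _).le,
    ← Real.exp_mul]
  congr 3
  ring_nf

theorem hasDerivAt_mellinPullback (σ : ℝ) (f : 𝓢(ℝ, ℂ)) (u : ℝ) :
    HasDerivAt (mellinPullback σ f)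
      (-σ * mellinPullback σ f u - mellinPullback (σ + 1) (SchwartzMap.derivCLM ℝ ℂ f) u) u := by
  have h1 : HasDerivAt (fun u : ℝ => Real.exp (-σ * u)) (Real.exp (-σ * u) * -σ) u := by
    simpa using ((hasDerivAt_id u).const_mul (-σ)).exp
  have h2 : HasDerivAt (fun u : ℝ => Real.exp (-u)) (-Real.exp (-u)) u := by
    simpa using (hasDerivAt_neg u).exp
  have h3 : HasDerivAt (fun u : ℝ => f (Real.exp (-u)))
      (-Real.exp (-u) • deriv f (Real.exp (-u))) u :=
    (f.differentiableAt.hasDerivAt).scomp u h2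
  refine (h1.smul h3).congr_deriv ?_
  simp only [mellinPullback, SchwartzMap.derivCLM_apply, real_smul]
  rw [show -(σ + 1) * u = -σ * u + -u by ring, Real.exp_add]
  push_cast
  ring

/-- A function with two integrable derivatives has an integrable Fourier transform, since
`(1 + (2πv)²) 𝓕 k v` is the Fourier transform of `k - k''` and hence bounded. -/
theorem integrable_fourier_of_hasDerivAt {k k₁ k₂ : ℝ → ℂ} (hk : Integrable k)
    (hk₁ : Integrable k₁) (hk₂ : Integrable k₂) (h₁ : ∀ u, HasDerivAt k (k₁ u) u)
    (h₂ : ∀ u, HasDerivAt k₁ (k₂ u) u) : Integrable (𝓕 k) := by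
  have e₁ : deriv k = k₁ := funext fun u => (h₁ u).deriv
  have e₂ : deriv k₁ = k₂ := funext fun u => (h₂ u).deriv
  have f₁ := Real.fourier_deriv hk (fun u => (h₁ u).differentiableAt) (e₁ ▸ hk₁)
  have f₂ := Real.fourier_deriv hk₁ (fun u => (h₂ u).differentiableAt) (e₂ ▸ hk₂)
  rw [e₁] at f₁
  rw [e₂, f₁] at f₂
  have hb : ∀ (f : ℝ → ℂ) (v : ℝ), ‖𝓕 f v‖ ≤ ∫ u, ‖f u‖ := fun f v => by
    rw [Real.fourier_eq]
    exact (norm_integral_le_integral_norm _).trans_eq (by simp)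
  have hbound : ∀ v : ℝ, ‖𝓕 k v‖ ≤ ((∫ u, ‖k u‖) + ∫ u, ‖k₂ u‖) * (1 + (2 * Real.pi * v) ^ 2)⁻¹ := by
    intro v
    rw [← div_eq_mul_inv, le_div_iff₀ (by positivity)]
    have e : ‖𝓕 k₂ v‖ = (2 * Real.pi * v) ^ 2 * ‖𝓕 k v‖ := by
      rw [f₂]
      simp only [norm_smul, norm_mul, norm_real, norm_I, Real.norm_eq_abs, Complex.norm_ofNat]
      rw [← sq_abs]
      simp only [abs_mul, abs_two]
      ring
    linarith [hb k v, hb k₂ v]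
  refine Integrable.mono' (g := fun v => ((∫ u, ‖k u‖) + ∫ u, ‖k₂ u‖) * (1 + (2 * Real.pi * v) ^ 2)⁻¹)
    ?_ ?_ (Eventually.of_forall hbound)
  · exact ((integrable_inv_one_add_sq.comp_mul_left' (by positivity : 2 * Real.pi ≠ 0))).const_mul _
  · exact (VectorFourier.fourierIntegral_continuous Real.continuous_fourierChar
      (L := innerₗ ℝ) continuous_inner hk).aestronglyMeasurable

theorem verticalIntegrable_mellin_schwartz (f : 𝓢(ℝ, ℂ)) {σ : ℝ} (hσ : 0 < σ) :
    VerticalIntegrable (mellin f) σ := by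
  have hint : ∀ (f : 𝓢(ℝ, ℂ)) {τ : ℝ}, 0 < τ → Integrable (mellinPullback τ f) :=
    fun f τ hτ => integrable_mellinPullback (mellinConvergent_schwartz f (by simpa using hτ))
  have key : Integrable (𝓕 (mellinPullback σ f)) := by
    refine integrable_fourier_of_hasDerivAt (hint f hσ) ?_ ?_ (hasDerivAt_mellinPullback σ f)
      fun u => ((hasDerivAt_mellinPullback σ f u).const_mul _).sub
        (hasDerivAt_mellinPullback (σ + 1) _ u)
    · exact ((hint f hσ).const_mul _).sub (hint _ (by positivity))
    · exact (((((hint f hσ).const_mul _).sub (hint _ (by positivity))).const_mul _)).sub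
        (((hint _ (by positivity)).const_mul _).sub (hint _ (by positivity)))
  have h2 := key.comp_div (by positivity : 2 * Real.pi ≠ 0)
  refine h2.congr (Eventually.of_forall fun t => ?_)
  have e1 : ((σ : ℂ) + t * I).re = σ := by simp
  have e2 : ((σ : ℂ) + t * I).im = t := by simp
  simp only [mellin_eq_fourier, e1, e2]
  rfl

/-- Mellin inversion for Schwartz functions, with the absolute convergence of the integral. -/
theorem integral_cpow_smul_mellin_schwartz (f : 𝓢(ℝ, ℂ)) {σ : ℝ} (hσ : 0 < σ) {x : ℝ}
    (hx : 0 < x) :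
    Integrable (fun t : ℝ => (x : ℂ) ^ (-(σ + t * I)) • mellin f (σ + t * I)) ∧
      ∫ t : ℝ, (x : ℂ) ^ (-(σ + t * I)) • mellin f (σ + t * I) = 2 * Real.pi * f x := by
  have hx0 : (x : ℂ) ≠ 0 := by exact_mod_cast hx.ne'
  constructor
  · refine Integrable.bdd_mul (c := x ^ (-σ)) (verticalIntegrable_mellin_schwartz f hσ)
      (Continuous.aestronglyMeasurable (by
        refine Continuous.const_cpow (by fun_prop) (Or.inl hx0))) (Eventually.of_forall fun t => ?_)
    rw [norm_cpow_eq_rpow_re_of_pos hx]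
    simp
  · have h := mellinInv_mellin_eq σ f hx (mellinConvergent_schwartz f (by simpa using hσ))
      (verticalIntegrable_mellin_schwartz f hσ) f.continuous.continuousAt
    rw [mellinInv] at h
    rw [← h, real_smul]
    push_cast
    rw [← mul_assoc, mul_one_div_cancel (by simp), one_mul]

/-! ### The local functional equation at the real place -/

/-- The Gaussian transform `t ↦ ∫₀^∞ f(x) exp(-π t x²) dx`. -/
def gaussTransform (f : ℝ → ℂ) (t : ℝ) : ℂ :=
  ∫ x in Ioi (0 : ℝ), f x * Real.exp (-(Real.pi * x ^ 2 * t))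

/-- Interchange the integrals over `x` and `t`: the inner one becomes a Gamma integral,
`∫₀^∞ t^(w-1) exp(-π t x²) dt = Γ(w) (π x²)^(-w)`. -/
theorem mellin_gaussTransform {f : ℝ → ℂ} (hf : Continuous f) {w : ℂ} (hw : 0 < w.re)
    (hfw : MellinConvergent f (1 - 2 * w)) :
    mellin (gaussTransform f) w = (Real.pi : ℂ) ^ (-w) * Complex.Gamma w * mellin f (1 - 2 * w) := by
  have hpow : ∀ x : ℝ, 0 < x → (1 / ((Real.pi * x ^ 2 : ℝ) : ℂ)) ^ w
      = (Real.pi : ℂ) ^ (-w) * (x : ℂ) ^ (1 - 2 * w - 1) := by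
    intro x hx
    have hx0 : (x : ℂ) ≠ 0 := by exact_mod_cast hx.ne'
    rw [one_div, inv_cpow _ _ (by rw [arg_ofReal_of_nonneg (by positivity)]; exact Real.pi_pos.ne),
      ← cpow_neg, sq, ofReal_mul, ofReal_mul,
      ← ofReal_mul x x, mul_cpow_ofReal_nonneg Real.pi_pos.le (by positivity), ofReal_mul,
      mul_cpow_ofReal_nonneg hx.le hx.le, ← cpow_add _ _ hx0]
    ring_nf
  have hexp : ∀ x t : ℝ, (t : ℂ) ^ (w - 1) * (f x * Real.exp (-(Real.pi * x ^ 2 * t)))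
      = f x * ((t : ℂ) ^ (w - 1) * cexp (-((Real.pi * x ^ 2 : ℝ) * t))) := fun x t => by
    push_cast; ring
  have hint : Integrable (fun q : ℝ × ℝ => (q.1 : ℂ) ^ (w - 1) * (f q.2 *
      Real.exp (-(Real.pi * q.2 ^ 2 * q.1))))
      ((volume.restrict (Ioi 0)).prod (volume.restrict (Ioi 0))) := by
    have hmeas : AEStronglyMeasurable (fun q : ℝ × ℝ => (q.1 : ℂ) ^ (w - 1) * (f q.2 *
      Real.exp (-(Real.pi * q.2 ^ 2 * q.1))))
      ((volume.restrict (Ioi 0)).prod (volume.restrict (Ioi 0))) := by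
      rw [Measure.prod_restrict]
      refine ContinuousOn.aestronglyMeasurable ?_ (measurableSet_Ioi.prod measurableSet_Ioi)
      refine ContinuousOn.mul ?_ (by fun_prop)
      refine ContinuousOn.cpow_const (by fun_prop) fun q hq => ?_
      exact Or.inl (by simpa using hq.1)
    rw [integrable_prod_iff' hmeas]
    constructor
    · filter_upwards [ae_restrict_mem measurableSet_Ioi] with x hx
      have hx : 0 < x := hx
      have h := integral_cpow_mul_exp_neg_mul_Ioi hw (r := Real.pi * x ^ 2) (by positivity)
      simp only [hexp]
      -- The Gamma integral converges because its value is not the junk value `0`.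
      refine Integrable.const_mul (not_imp_comm.1 integral_undef ?_) _
      rw [h, hpow x hx]
      have hx0 : (x : ℂ) ≠ 0 := by exact_mod_cast hx.ne'
      simp [cpow_eq_zero_iff, hx0, Complex.Gamma_ne_zero_of_re_pos hw]
    · have : ∀ x ∈ Ioi (0:ℝ), ∫ t in Ioi (0:ℝ), ‖(t : ℂ) ^ (w - 1) * (f x *
          Real.exp (-(Real.pi * x ^ 2 * t)))‖
          = Real.pi ^ (-w.re) * Real.Gamma w.re * ‖(x : ℂ) ^ (1 - 2 * w - 1) • f x‖ := by
        intro x hx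
        have hx : 0 < x := hx
        have h := Real.integral_rpow_mul_exp_neg_mul_Ioi hw (r := Real.pi * x ^ 2) (by positivity)
        have e : ∀ t ∈ Ioi (0 : ℝ), ‖(t : ℂ) ^ (w - 1) * (f x *
            Real.exp (-(Real.pi * x ^ 2 * t)))‖
            = ‖f x‖ * (t ^ (w.re - 1) * Real.exp (-(Real.pi * x ^ 2 * t))) := fun t ht => by
          rw [norm_mul, norm_mul, norm_cpow_eq_rpow_re_of_pos ht, norm_real, Real.norm_eq_abs,
            Real.abs_exp]
          simp only [sub_re, one_re]
          ring
        rw [setIntegral_congr_fun measurableSet_Ioi e, integral_const_mul, h, norm_smul,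
          norm_cpow_eq_rpow_re_of_pos hx, Real.div_rpow zero_le_one (by positivity),
          Real.mul_rpow Real.pi_pos.le (by positivity), ← Real.rpow_natCast_mul hx.le,
          Real.rpow_neg Real.pi_pos.le,
          show (1 - 2 * w - 1).re = -((2 : ℕ) * w.re) by simp, Real.rpow_neg hx.le, Real.one_rpow]
        field_simp
      refine IntegrableOn.congr_fun (f := fun x : ℝ =>
        Real.pi ^ (-w.re) * Real.Gamma w.re * ‖(x : ℂ) ^ (1 - 2 * w - 1) • f x‖) ?_
        (fun x hx => (this x hx).symm) measurableSet_Ioi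
      exact Integrable.const_mul hfw.norm _
  calc mellin (gaussTransform f) w
      = ∫ t in Ioi (0 : ℝ), ∫ x in Ioi (0 : ℝ), (t : ℂ) ^ (w - 1) * (f x *
          Real.exp (-(Real.pi * x ^ 2 * t))) := by
        simp only [mellin, gaussTransform, smul_eq_mul, integral_const_mul]
    _ = ∫ x in Ioi (0 : ℝ), ∫ t in Ioi (0 : ℝ), (t : ℂ) ^ (w - 1) * (f x *
          Real.exp (-(Real.pi * x ^ 2 * t))) := integral_integral_swap hint
    _ = ∫ x in Ioi (0 : ℝ), (Real.pi : ℂ) ^ (-w) * Complex.Gamma w *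
          ((x : ℂ) ^ (1 - 2 * w - 1) • f x) := by
        refine setIntegral_congr_fun measurableSet_Ioi fun x hx => ?_
        have hx : 0 < x := hx
        have h := integral_cpow_mul_exp_neg_mul_Ioi hw (r := Real.pi * x ^ 2) (by positivity)
        rw [hpow x hx] at h
        simp only [hexp, integral_const_mul, h, smul_eq_mul]
        ring_nf
    _ = _ := by rw [integral_const_mul]; rfl

theorem fourier_eq_fourierInv_of_even {f : ℝ → ℂ} (hf : ∀ x, f (-x) = f x) : 𝓕 f = 𝓕⁻ f := by
  funext x
  rw [Real.fourierInv_eq_fourier_comp_neg]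
  simp only [hf]

theorem fourier_even {f : ℝ → ℂ} (hf : ∀ x, f (-x) = f x) (x : ℝ) : 𝓕 f (-x) = 𝓕 f x := by
  rw [← Real.fourierInv_eq_fourier_neg, fourier_eq_fourierInv_of_even hf]

theorem integral_even {f : ℝ → ℂ} (hf : ∀ x, f (-x) = f x) :
    ∫ x, f x = 2 * ∫ x in Ioi (0 : ℝ), f x := by
  by_cases h : IntegrableOn f (Ioi 0)
  · have h' : IntegrableOn f (Iic 0) := by
      rw [← Measure.map_neg_eq_self (volume : Measure ℝ)]
      have m : MeasurableEmbedding fun x : ℝ => -x := (Homeomorph.neg ℝ).measurableEmbedding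
      rw [m.integrableOn_map_iff]
      simpa [Function.comp_def, hf, integrableOn_Ici_iff_integrableOn_Ioi] using h
    have e : ∫ x in Iic (0 : ℝ), f x = ∫ x in Ioi (0 : ℝ), f x := by
      simpa [hf] using integral_comp_neg_Iic (0 : ℝ) f
    rw [← intervalIntegral.integral_Iic_add_Ioi h' h, e, two_mul]
  · rw [integral_undef h, integral_undef fun h' => h h'.integrableOn, mul_zero]

/-- Self-adjointness of the Fourier transform against a Gaussian. -/
theorem gaussTransform_fourier {f : ℝ → ℂ} (hf : Integrable f) (he : ∀ x, f (-x) = f x)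
    {t : ℝ} (ht : 0 < t) :
    gaussTransform (𝓕 f) t = (t : ℂ) ^ (-(1 / 2) : ℂ) • gaussTransform f t⁻¹ := by
  have hG : Integrable (fun x : ℝ => cexp (-Real.pi * t * x ^ 2)) := by
    simpa using integrable_cexp_quadratic (b := Real.pi * t) (by simp; positivity) 0 0
  have hFG := fourier_gaussian_pi (b := (t : ℂ)) (by simpa using ht)
  have key := VectorFourier.integral_fourierIntegral_smul_eq_flip (L := innerₗ ℝ)
    Real.continuous_fourierChar continuous_inner hf hG
  have key2 : ∫ x, 𝓕 f x * cexp (-Real.pi * t * x ^ 2)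
      = ∫ x, f x * (𝓕 (fun x : ℝ => cexp (-Real.pi * t * x ^ 2))) x := by
    simpa using! key
  rw [hFG, integral_even, integral_even] at key2
  · have key3 := mul_left_cancel₀ two_ne_zero key2
    rw [gaussTransform, gaussTransform, smul_eq_mul, ← integral_const_mul]
    convert key3 using 1
    · congr 1
      funext x
      push_cast
      ring_nf
    · congr 1
      funext x
      push_cast
      rw [cpow_neg]
      ring_nf
  · intro x
    simp [he]
  · intro x
    simp [fourier_even he]

/-- **Local functional equation** at the real place, for even Schwartz functions. -/
theorem mellin_fourier_eq_div_tateGammaReal (f : 𝓢(ℝ, ℂ)) (he : ∀ x, f (-x) = f x) {s : ℂ}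
    (hs0 : 0 < s.re) (hs1 : s.re < 1) :
    mellin (𝓕 f : 𝓢(ℝ, ℂ)) (1 - s) = mellin f s / tateGammaReal s := by
  have h1 := mellin_gaussTransform (𝓕 f : 𝓢(ℝ, ℂ)).continuous (w := s / 2) (by simpa using hs0)
    (mellinConvergent_schwartz _ (by simp; linarith))
  have h2 := mellin_gaussTransform f.continuous (w := 1 / 2 - s / 2)
    (by simp; linarith) (mellinConvergent_schwartz _ (by ring_nf; simpa using hs0))
  -- The substitution `t ↦ 1 / t` and the factor `t^(-1/2)` turn `s / 2` into `1 / 2 - s / 2`.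
  have h3 : mellin (gaussTransform (𝓕 f : 𝓢(ℝ, ℂ))) (s / 2)
      = mellin (gaussTransform f) (1 / 2 - s / 2) := by
    rw [show (1 / 2 - s / 2 : ℂ) = -(s / 2 + -(1 / 2)) by ring, ← mellin_comp_inv,
      ← mellin_cpow_smul]
    exact setIntegral_congr_fun measurableSet_Ioi fun t ht => by
      simp only
      rw [← gaussTransform_fourier f.integrable he ht]
      rfl
  rw [h1, h2] at h3
  rw [show 1 - 2 * (s / 2) = 1 - s by ring, show 1 - 2 * (1 / 2 - s / 2) = s by ring] at h3
  have hG1 : Complex.Gamma (s / 2) ≠ 0 := Complex.Gamma_ne_zero_of_re_pos (by simpa using hs0)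
  have hG2 : Complex.Gamma ((1 - s) / 2) ≠ 0 :=
    Complex.Gamma_ne_zero_of_re_pos (by simp; linarith)
  have hpi : (Real.pi : ℂ) ≠ 0 := by exact_mod_cast Real.pi_ne_zero
  have hp1 : (Real.pi : ℂ) ^ (1 / 2 - s) ≠ 0 := by simp [cpow_eq_zero_iff, hpi]
  have hp2 : (Real.pi : ℂ) ^ (-(1 / 2 - s / 2)) ≠ 0 := by simp [cpow_eq_zero_iff, hpi]
  have e : (Real.pi : ℂ) ^ (-(s / 2)) = (Real.pi : ℂ) ^ (1 / 2 - s) *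
      (Real.pi : ℂ) ^ (-(1 / 2 - s / 2)) := by
    rw [← cpow_add _ _ hpi]
    congr 1
    ring
  rw [show (1 / 2 - s / 2 : ℂ) = (1 - s) / 2 by ring] at *
  rw [tateGammaReal, eq_div_iff (by positivity)]
  rw [mul_div_assoc', mul_div_assoc', div_eq_iff hG2]
  apply mul_left_cancel₀ hp2
  rw [e] at h3
  linear_combination h3

/-- This exhibits `g(|y|)` as a smooth function of `y`, including at `0`. -/
theorem comp_abs_eq_add_comp_neg {g : ℝ → ℂ} (hgs : tsupport g ⊆ Ioi 0) (y : ℝ) :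
    g |y| = g y + g (-y) := by
  have h0 : ∀ x ≤ 0, g x = 0 := fun x hx =>
    image_eq_zero_of_notMem_tsupport fun h => absurd (hgs h) (not_lt.2 hx)
  rcases le_total 0 y with h | h
  · rw [abs_of_nonneg h, h0 (-y) (by linarith), add_zero]
  · rw [abs_of_nonpos h, h0 y h, zero_add]

theorem exists_schwartz_eq_comp_abs {g : ℝ → ℂ} (hg : ContDiff ℝ ∞ g) (hgc : HasCompactSupport g)
    (hgs : tsupport g ⊆ Ioi 0) : ∃ φ : 𝓢(ℝ, ℂ), ∀ y, φ y = g |y| := by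
  have hc : HasCompactSupport (fun y => g y + g (-y)) :=
    hgc.add (hgc.comp_homeomorph (Homeomorph.neg ℝ))
  have hs : ContDiff ℝ ∞ (fun y => g y + g (-y)) := hg.add (hg.comp contDiff_neg)
  exact ⟨hc.toSchwartzMap hs, fun y => (comp_abs_eq_add_comp_neg hgs y).symm⟩

theorem mellin_inversion_real_place {g : ℝ → ℂ} (hg : ContDiff ℝ ∞ g) (hgc : HasCompactSupport g)
    (hgs : tsupport g ⊆ Ioi 0) {c : ℝ} (hc0 : 0 < c) (hc1 : c < 1) {x : ℝ} (hx : x ≠ 0) :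
    VerticalIntegrable (fun s => mellin g s * ((|x| : ℝ) : ℂ) ^ (s - 1) / tateGammaReal s) c ∧
      𝓕⁻ (fun y : ℝ => g |y|) x = 1 / (2 * Real.pi * I) * lineIntegral c
        (fun s => mellin g s * ((|x| : ℝ) : ℂ) ^ (s - 1) / tateGammaReal s) := by
  obtain ⟨φ, hφ⟩ := exists_schwartz_eq_comp_abs hg hgc hgs
  have he : ∀ y, φ (-y) = φ y := fun y => by rw [hφ, hφ, abs_neg]
  have hm : ∀ s, mellin φ s = mellin g s := fun s =>
    setIntegral_congr_fun measurableSet_Ioi fun t ht => by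
      simp only [hφ, abs_of_pos (show (0 : ℝ) < t from ht)]
  have hx' : 0 < |x| := abs_pos.2 hx
  -- On the line, the integrand is the one of the inversion formula for `𝓕 φ` at `1 - s`.
  have hF : ∀ t : ℝ, mellin g (c + t * I) * ((|x| : ℝ) : ℂ) ^ ((c + t * I : ℂ) - 1) /
      tateGammaReal (c + t * I) = ((|x| : ℝ) : ℂ) ^ (-(((1 - c : ℝ) : ℂ) + (-t : ℝ) * I)) •
        mellin (𝓕 φ : 𝓢(ℝ, ℂ)) (((1 - c : ℝ) : ℂ) + (-t : ℝ) * I) := by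
    intro t
    have h := mellin_fourier_eq_div_tateGammaReal φ he (s := c + t * I) (by simpa) (by simpa)
    rw [hm] at h
    have e : ((1 - c : ℝ) : ℂ) + (-t : ℝ) * I = 1 - (c + t * I) := by push_cast; ring
    rw [e, h, smul_eq_mul, neg_sub]
    ring
  obtain ⟨hi, hv⟩ := integral_cpow_smul_mellin_schwartz (𝓕 φ : 𝓢(ℝ, ℂ)) (sub_pos.2 hc1) hx'
  constructor
  · exact (hi.comp_neg).congr (Eventually.of_forall fun t => (hF t).symm)
  · have hL : ∫ t : ℝ, mellin g (c + t * I) * ((|x| : ℝ) : ℂ) ^ ((c + t * I : ℂ) - 1) /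
        tateGammaReal (c + t * I) = 2 * Real.pi * (𝓕 φ : 𝓢(ℝ, ℂ)) |x| := by
      simp only [hF]
      rw [← hv, ← integral_neg_eq_self]
      simp only [neg_neg]
    have hφ' : (fun y => g |y|) = φ := funext fun y => (hφ y).symm
    have hxx : (𝓕 φ : 𝓢(ℝ, ℂ)) |x| = 𝓕⁻ (fun y : ℝ => g |y|) x := by
      rw [hφ', ← fourier_eq_fourierInv_of_even he]
      rcases abs_choice x with h | h
      · rw [h]; rfl
      · rw [h]; exact fourier_even he x
    rw [lineIntegral, integral_mul_const, hL, hxx]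
    have : (Real.pi : ℂ) ≠ 0 := by exact_mod_cast Real.pi_ne_zero
    field_simp

/-! ### Haar measure and characters on `ℚ_p` -/

section Padic

variable {p : ℕ} [hp : Fact p.Prime]

instance isAddHaarMeasure_padicHaar : (padicHaar p).IsAddHaarMeasure := by
  unfold padicHaar
  infer_instance

theorem padicHaar_closedBall_center (a : ℚ_[p]) (r : ℝ) :
    padicHaar p (Metric.closedBall a r) = padicHaar p (Metric.closedBall 0 r) := by
  rw [← measure_preimage_add (padicHaar p) a (Metric.closedBall a r)]
  congr 1
  ext y
  simp [dist_eq_norm]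

/-- A ball of radius `p ^ (m + 1)` is the disjoint union of `p` balls of radius `p ^ m`. -/
theorem closedBall_zpow_succ (m : ℤ) :
    Metric.closedBall (0 : ℚ_[p]) ((p : ℝ) ^ (m + 1)) =
      ⋃ i ∈ Finset.range p, Metric.closedBall ((i : ℚ_[p]) * (p : ℚ_[p]) ^ (-(m + 1)))
        ((p : ℝ) ^ m) := by
  have hp0 : (0 : ℝ) < p := by exact_mod_cast hp.out.pos
  have hpQ : (p : ℚ_[p]) ≠ 0 := by exact_mod_cast hp.out.ne_zero
  ext y
  simp only [mem_iUnion, Metric.mem_closedBall, dist_eq_norm, sub_zero, Finset.mem_range,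
    exists_prop]
  constructor
  · intro hy
    have hz : ‖y * (p : ℚ_[p]) ^ (m + 1)‖ ≤ 1 := by
      rw [norm_mul, Padic.norm_p_zpow, zpow_neg, ← div_eq_mul_inv]
      exact div_le_one_of_le₀ hy (by positivity)
    obtain ⟨z, hz⟩ : ∃ z : ℤ_[p], (z : ℚ_[p]) = y * (p : ℚ_[p]) ^ (m + 1) := ⟨⟨_, hz⟩, rfl⟩
    obtain ⟨i, hi, hi2⟩ := PadicInt.exists_mem_range z
    refine ⟨i, hi, ?_⟩
    rw [PadicInt.maximalIdeal_eq_span_p, ← pow_one (p : ℤ_[p]),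
      ← PadicInt.norm_le_pow_iff_mem_span_pow, PadicInt.norm_def, PadicInt.coe_sub,
      PadicInt.coe_natCast, hz] at hi2
    have e : y - i * (p : ℚ_[p]) ^ (-(m + 1)) = (y * (p : ℚ_[p]) ^ (m + 1) - i) *
        (p : ℚ_[p]) ^ (-(m + 1)) := by
      rw [sub_mul, mul_assoc, ← zpow_add₀ hpQ]
      simp
    rw [e, norm_mul, Padic.norm_p_zpow, neg_neg]
    calc _ ≤ (p : ℝ) ^ (-((1 : ℕ) : ℤ)) * (p : ℝ) ^ (m + 1) := by gcongr
      _ = _ := by rw [← zpow_add₀ hp0.ne']; congr 1; push_cast; ring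
  · rintro ⟨i, -, hi⟩
    have h1 : ‖(i : ℚ_[p]) * (p : ℚ_[p]) ^ (-(m + 1))‖ ≤ (p : ℝ) ^ (m + 1) := by
      rw [norm_mul, Padic.norm_p_zpow, neg_neg]
      exact mul_le_of_le_one_left (by positivity) (by simpa using Padic.norm_int_le_one i)
    have h2 := (IsUltrametricDist.norm_add_le_max (y - i * (p : ℚ_[p]) ^ (-(m + 1)))
      (i * (p : ℚ_[p]) ^ (-(m + 1)))).trans (max_le (hi.trans ?_) h1)
    · simpa using h2
    · exact zpow_le_zpow_right₀ (by exact_mod_cast hp.out.one_lt.le) (by omega)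

theorem padicHaar_closedBall_zpow_succ (m : ℤ) :
    padicHaar p (Metric.closedBall 0 ((p : ℝ) ^ (m + 1))) =
      p * padicHaar p (Metric.closedBall 0 ((p : ℝ) ^ m)) := by
  have hp0 : (0 : ℝ) < p := by exact_mod_cast hp.out.pos
  rw [closedBall_zpow_succ, measure_biUnion_finset _ fun _ _ => Metric.isClosed_closedBall.measurableSet]
  · simp [padicHaar_closedBall_center]
  · intro i hi j hj hij
    refine Set.disjoint_left.2 fun y hyi hyj => hij ?_
    simp only [Metric.mem_closedBall, dist_eq_norm, Finset.coe_range, mem_Iio] at hyi hyj hi hj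
    have h1 : ‖((i : ℤ) - (j : ℤ) : ℤ) * (p : ℚ_[p]) ^ (-(m + 1))‖ ≤ (p : ℝ) ^ m := by
      have e : ((i : ℤ) - (j : ℤ) : ℤ) * (p : ℚ_[p]) ^ (-(m + 1)) =
          (y - j * (p : ℚ_[p]) ^ (-(m + 1))) + -(y - i * (p : ℚ_[p]) ^ (-(m + 1))) := by
        push_cast; ring
      rw [e]
      exact (IsUltrametricDist.norm_add_le_max _ _).trans (max_le hyj (by rwa [norm_neg]))
    rw [norm_mul, Padic.norm_p_zpow, neg_neg, zpow_add₀ hp0.ne', zpow_one, mul_comm, mul_assoc,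
      mul_le_iff_le_one_right (by positivity)] at h1
    have h2 : ‖(((i : ℤ) - (j : ℤ) : ℤ) : ℚ_[p])‖ < 1 := by
      have : (1 : ℝ) < p := by exact_mod_cast hp.out.one_lt
      by_contra! h3
      nlinarith
    rw [Padic.norm_intCast_lt_one_iff] at h2
    have := Int.eq_zero_of_abs_lt_dvd h2 (by rw [abs_lt]; omega)
    omega

theorem padicHaar_closedBall_zpow (m : ℤ) :
    padicHaar p (Metric.closedBall 0 ((p : ℝ) ^ m)) = ENNReal.ofReal ((p : ℝ) ^ m) := by
  have hp0 : (0 : ℝ) < p := by exact_mod_cast hp.out.pos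
  have hs : ∀ m : ℤ, ENNReal.ofReal ((p : ℝ) ^ (m + 1)) = p * ENNReal.ofReal ((p : ℝ) ^ m) := by
    intro m
    rw [zpow_add₀ hp0.ne', zpow_one, mul_comm, ENNReal.ofReal_mul hp0.le, ENNReal.ofReal_natCast]
  induction m using Int.induction_on with
  | zero =>
    simpa [padicHaar] using! Measure.addHaarMeasure_self (K₀ := padicIntegersCompacts p)
  | succ i ih => rw [padicHaar_closedBall_zpow_succ, hs, ih]
  | pred i ih =>
    have h := padicHaar_closedBall_zpow_succ (p := p) (-(i : ℤ) - 1)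
    have h' := hs (-(i : ℤ) - 1)
    rw [sub_add_cancel] at h h'
    rw [ih, h'] at h
    exact (ENNReal.mul_right_inj (by simpa using hp.out.ne_zero) (by simp)).1 h.symm

/-- `x` and `{x}_p` differ by an element of `ℤ_p`, and `{x}_p` has `p`-power denominator. -/
theorem padicFract_mem_int_iff (x : ℚ_[p]) : (∃ k : ℤ, padicFract x = k) ↔ ‖x‖ ≤ 1 := by
  have hx := norm_sub_padicFract_le_one x
  constructor
  · rintro ⟨k, hk⟩
    rw [hk] at hx
    have h2 := (IsUltrametricDist.norm_add_le_max (x - ((k : ℚ) : ℚ_[p])) (k : ℚ_[p])).trans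
      (max_le hx (Padic.norm_int_le_one k))
    simpa using h2
  · intro h
    have hpQ : (p : ℚ) ≠ 0 := by exact_mod_cast hp.out.ne_zero
    refine exists_int_of_norm_le_one (p := p) _ (-x.valuation).toNat
      (PadicInt.appr (padicNumerator x) (-x.valuation).toNat : ℤ) ?_ ?_
    · rw [padicFract, div_mul_cancel₀ _ (pow_ne_zero _ hpQ)]
      norm_cast
    · have h2 := (IsUltrametricDist.norm_add_le_max x (-(x - (padicFract x : ℚ_[p])))).trans
        (max_le h (by rwa [norm_neg]))
      simpa using h2

theorem padicChar_eq_one_iff (x : ℚ_[p]) : padicChar p x = 1 ↔ ‖x‖ ≤ 1 := by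
  rw [← padicFract_mem_int_iff]
  change Circle.exp _ = 1 ↔ _
  rw [Circle.exp_eq_one]
  have hpi : 2 * Real.pi ≠ 0 := by positivity
  constructor
  · rintro ⟨k, hk⟩
    refine ⟨-k, ?_⟩
    have : (padicFract x : ℝ) = ((-k : ℤ) : ℝ) := by
      apply mul_left_cancel₀ hpi
      push_cast
      linarith
    exact_mod_cast this
  · rintro ⟨k, hk⟩
    refine ⟨-k, ?_⟩
    rw [hk]
    push_cast
    ring

/-- The character is locally constant, being trivial on the open subgroup `ℤ_p`. -/
theorem continuous_padicChar : Continuous (padicChar p) := by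
  refine (IsLocallyConstant.iff_exists_open _).2 (fun x => ?_) |>.continuous
  refine ⟨Metric.closedBall x 1, IsUltrametricDist.isOpen_closedBall x one_ne_zero, by simp,
    fun y hy => ?_⟩
  have h : padicChar p (y - x) = 1 := by
    rw [padicChar_eq_one_iff]
    simpa [dist_eq_norm] using hy
  rw [← sub_add_cancel y x, AddChar.map_add_eq_mul, h, one_mul]

/-- Orthogonality of characters: the character `y ↦ ψ_p(x y)` integrates to zero over a ball on which it is
not trivial. -/
theorem setIntegral_padicChar (x : ℚ_[p]) (m : ℤ) :
    ∫ y in Metric.closedBall 0 ((p : ℝ) ^ m), (padicChar p (x * y) : ℂ) ∂(padicHaar p) =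
      if ‖x‖ * (p : ℝ) ^ m ≤ 1 then ((p : ℝ) ^ m : ℝ) else 0 := by
  have hp0 : (0 : ℝ) < p := by exact_mod_cast hp.out.pos
  split_ifs with h
  · have e : ∀ y ∈ Metric.closedBall (0 : ℚ_[p]) ((p : ℝ) ^ m), (padicChar p (x * y) : ℂ) = 1 := by
      intro y hy
      rw [(padicChar_eq_one_iff _).2]
      · simp
      · rw [norm_mul]
        refine le_trans ?_ h
        gcongr
        simpa using hy
    rw [setIntegral_congr_fun Metric.isClosed_closedBall.measurableSet e]
    rw [setIntegral_const, measureReal_def, padicHaar_closedBall_zpow, ENNReal.toReal_ofReal (by positivity)]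
    simp
  · -- Translating the ball by an element `a` of it with `ψ_p(x a) ≠ 1` multiplies the integral by
    -- `ψ_p(x a)`, so the integral vanishes.
    set B := Metric.closedBall (0 : ℚ_[p]) ((p : ℝ) ^ m)
    set a : ℚ_[p] := (p : ℚ_[p]) ^ (-m) with ha_def
    have ha : ‖a‖ = (p : ℝ) ^ m := by rw [Padic.norm_p_zpow, neg_neg]
    have hψ : padicChar p (x * a) ≠ 1 := by
      rw [Ne, padicChar_eq_one_iff, norm_mul, ha]
      exact h
    set J := ∫ y in B, (padicChar p (x * y) : ℂ) ∂(padicHaar p)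
    have hJ : J = (padicChar p (x * a) : ℂ) * J := by
      have hBi : ∀ y, y + a ∈ B ↔ y ∈ B := by
        intro y
        simp only [B, mem_closedBall_zero_iff]
        constructor
        · intro hy
          have := (IsUltrametricDist.norm_add_le_max (y + a) (-a)).trans
            (max_le hy (by rw [norm_neg, ha]))
          simpa using this
        · intro hy
          exact (IsUltrametricDist.norm_add_le_max y a).trans (max_le hy ha.le)
      have hB : MeasurableSet B := Metric.isClosed_closedBall.measurableSet
      calc J = ∫ y, B.indicator (fun y => (padicChar p (x * y) : ℂ)) y ∂(padicHaar p) :=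
            (integral_indicator hB).symm
        _ = ∫ y, B.indicator (fun y => (padicChar p (x * y) : ℂ)) (y + a) ∂(padicHaar p) :=
            (integral_add_right_eq_self _ a).symm
        _ = ∫ y, (padicChar p (x * a) : ℂ) *
              B.indicator (fun y => (padicChar p (x * y) : ℂ)) y ∂(padicHaar p) := by
            congr 1
            funext y
            by_cases hy : y ∈ B
            · rw [indicator_of_mem hy, indicator_of_mem ((hBi y).2 hy), mul_add,
                AddChar.map_add_eq_mul, Circle.coe_mul, mul_comm]
            · rw [indicator_of_notMem hy, indicator_of_notMem (mt (hBi y).1 hy), mul_zero]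
        _ = _ := by rw [integral_const_mul, integral_indicator hB]
    have h1 : (1 - (padicChar p (x * a) : ℂ)) * J = 0 := by linear_combination hJ
    rcases mul_eq_zero.1 h1 with h2 | h2
    · exact absurd (Circle.ext (by simpa using (sub_eq_zero.1 h2).symm)) hψ
    · exact h2

/-! ### Radial functions on `ℚ_p` -/

/-- Telescoping over the values of the absolute value, from the largest down. -/
theorem sum_range_sub_ite (u : ℤ → ℂ) (N k : ℤ) (hk : k ≤ N) (M : ℕ) :
    ∑ i ∈ Finset.range M, (u (N - i) - u (N - i + 1)) * (if k ≤ N - i then 1 else 0) =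
      u (max k (N - M + 1)) - u (N + 1) := by
  induction M with
  | zero => simp [max_eq_right (show k ≤ N + 1 by omega)]
  | succ M ih =>
    rw [Finset.sum_range_succ, ih]
    split_ifs with h
    · rw [max_eq_right (by omega), max_eq_right (by push_cast; omega)]
      push_cast
      ring_nf
    · rw [max_eq_left (by omega), max_eq_left (by push_cast; omega)]
      ring

/-- Only finitely many powers of `p` lie in the support of `g`. -/
theorem exists_forall_zpow_eq_zero {g : ℝ → ℂ} (hgc : HasCompactSupport g)
    (hgs : tsupport g ⊆ Ioi 0) :
    ∃ K : ℕ, ∀ m : ℤ, (K : ℤ) ≤ |m| → g ((p : ℝ) ^ m) = 0 := by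
  have hp1 : (1 : ℝ) < p := by exact_mod_cast hp.out.one_lt
  have hp0 : (0 : ℝ) < p := by linarith
  have h0 : ∀ᶠ x in 𝓝 (0 : ℝ), g x = 0 := by
    have : (0 : ℝ) ∉ tsupport g := fun h => lt_irrefl (0 : ℝ) (hgs h)
    exact notMem_tsupport_iff_eventuallyEq.1 this
  have h1 : ∀ᶠ x in atTop, g x = 0 := by
    obtain ⟨R, hR⟩ := hgc.isCompact.bddAbove
    filter_upwards [eventually_gt_atTop R] with x hx
    exact image_eq_zero_of_notMem_tsupport fun h => absurd (hR h) (not_le.2 hx)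
  have t0 : Tendsto (fun n : ℕ => ((p : ℝ)⁻¹) ^ n) atTop (𝓝 0) :=
    tendsto_pow_atTop_nhds_zero_of_lt_one (by positivity) (inv_lt_one_of_one_lt₀ hp1)
  have t1 : Tendsto (fun n : ℕ => (p : ℝ) ^ n) atTop atTop := tendsto_pow_atTop_atTop_of_one_lt hp1
  obtain ⟨K, hK⟩ := eventually_atTop.1 ((t0.eventually h0).and (t1.eventually h1))
  refine ⟨K, fun m hm => ?_⟩
  have hK' := hK m.natAbs (by rw [Int.abs_eq_natAbs] at hm; omega)
  rcases le_total 0 m with h | h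
  · have := hK'.2
    rw [← zpow_natCast, Int.natCast_natAbs, abs_of_nonneg h] at this
    exact this
  · have := hK'.1
    rw [inv_pow, ← zpow_natCast, Int.natCast_natAbs, abs_of_nonpos h, ← zpow_neg, neg_neg] at this
    exact this

/-- A radial function whose profile vanishes near `0` and `∞` is a combination of indicator
functions of balls. -/
theorem radial_eq_sum_indicator {g : ℝ → ℂ} (h0 : g 0 = 0) {N : ℤ} {M : ℕ}
    (hN : ∀ m, N < m → g ((p : ℝ) ^ m) = 0) (hM : ∀ m, m ≤ N - M + 1 → g ((p : ℝ) ^ m) = 0)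
    (y : ℚ_[p]) :
    g ‖y‖ = ∑ i ∈ Finset.range M, (g ((p : ℝ) ^ (N - i)) - g ((p : ℝ) ^ (N - i + 1))) *
      (Metric.closedBall (0 : ℚ_[p]) ((p : ℝ) ^ (N - i))).indicator 1 y := by
  have hp1 : (1 : ℝ) < p := by exact_mod_cast hp.out.one_lt
  have hp0 : (0 : ℝ) < p := by linarith
  by_cases hy : y = 0
  · subst hy
    have h := sum_range_sub_ite (fun m => g ((p : ℝ) ^ m)) N (min N (N - M)) (min_le_left _ _) M
    have e : ∀ i ∈ Finset.range M, (if min N (N - M) ≤ N - (i : ℤ) then (1 : ℂ) else 0) =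
        (Metric.closedBall (0 : ℚ_[p]) ((p : ℝ) ^ (N - i))).indicator 1 0 := by
      intro i hi
      rw [Finset.mem_range] at hi
      rw [if_pos (by omega), indicator_of_mem (by simp; positivity)]
      rfl
    rw [Finset.sum_congr rfl fun i hi => by rw [e i hi]] at h
    rw [h, norm_zero, h0, max_eq_right (by omega), hM _ le_rfl, hN _ (by omega), sub_zero]
  · obtain ⟨k, hk⟩ : ∃ k : ℤ, ‖y‖ = (p : ℝ) ^ k := ⟨_, Padic.norm_eq_zpow_neg_valuation hy⟩
    have e : ∀ m : ℤ, (Metric.closedBall (0 : ℚ_[p]) ((p : ℝ) ^ m)).indicator (1 : ℚ_[p] → ℂ) y =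
        if k ≤ m then 1 else 0 := by
      intro m
      split_ifs with h
      · exact indicator_of_mem (by simpa [hk] using zpow_le_zpow_right₀ hp1.le h) _
      · exact indicator_of_notMem (by simpa [hk, zpow_le_zpow_iff_right₀ hp1] using h) _
    rw [Finset.sum_congr rfl fun i _ => by rw [e], hk]
    rcases le_or_gt k N with h | h
    · rw [sum_range_sub_ite (fun m => g ((p : ℝ) ^ m)) N k h M, hN (N + 1) (by omega), sub_zero]
      rcases le_total k (N - M + 1) with h2 | h2
      · rw [max_eq_right h2, hM _ le_rfl, hM _ h2]
      · rw [max_eq_left h2]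
    · rw [hN k h]
      refine (Finset.sum_eq_zero fun i _ => ?_).symm
      rw [if_neg (by omega), mul_zero]

theorem integrable_indicator_closedBall (r : ℝ) :
    Integrable ((Metric.closedBall (0 : ℚ_[p]) r).indicator (1 : ℚ_[p] → ℂ)) (padicHaar p) :=
  (integrable_indicator_iff Metric.isClosed_closedBall.measurableSet).2
    (integrableOn_const (isCompact_closedBall _ _).measure_lt_top.ne)

theorem integrable_radial {g : ℝ → ℂ} (hgc : HasCompactSupport g) (hgs : tsupport g ⊆ Ioi 0) :
    Integrable (fun y : ℚ_[p] => g ‖y‖) (padicHaar p) := by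
  obtain ⟨K, hK⟩ := exists_forall_zpow_eq_zero (p := p) hgc hgs
  have h0 : g 0 = 0 := image_eq_zero_of_notMem_tsupport fun h => lt_irrefl (0 : ℝ) (hgs h)
  have e := radial_eq_sum_indicator (p := p) h0 (N := K) (M := 2 * K + 1)
    (fun m hm => hK m (by rw [le_abs]; omega)) (fun m hm => hK m (by rw [le_abs]; push_cast at hm; omega))
  rw [funext e]
  exact integrable_finsetSum _ fun i _ => (integrable_indicator_closedBall _).const_mul _

/-- The Fourier transform of a radial function on `ℚ_p`, as a sum over the balls on which the
character `y ↦ ψ_p(x y)` is trivial. -/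
theorem hasSum_padicFourierInv_radial {g : ℝ → ℂ} (hgc : HasCompactSupport g)
    (hgs : tsupport g ⊆ Ioi 0) {x : ℚ_[p]} {n : ℤ} (hx : ‖x‖ = (p : ℝ) ^ n) :
    HasSum (fun j : ℕ => ((p : ℝ) ^ (-n - j) : ℝ) *
      (g ((p : ℝ) ^ (-n - j)) - g ((p : ℝ) ^ (-n - j + 1))))
      (padicFourierInv (fun y : ℚ_[p] => g ‖y‖) x) := by
  have hp1 : (1 : ℝ) < p := by exact_mod_cast hp.out.one_lt
  have hp0 : (0 : ℝ) < p := by linarith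
  obtain ⟨K, hK⟩ := exists_forall_zpow_eq_zero (p := p) hgc hgs
  have h0 : g 0 = 0 := image_eq_zero_of_notMem_tsupport fun h => lt_irrefl (0 : ℝ) (hgs h)
  -- Use balls of radius `p^m` for `m = A - n, A - n - 1, …`; the first `A` of them have `m > -n` and
  -- contribute nothing, and `A ≥ K + |n|` makes the range of `m` contain the support of `g`.
  set A : ℕ := K + n.natAbs with hA
  have e := radial_eq_sum_indicator (p := p) h0 (N := A - n) (M := A + (A + 1))
    (fun m hm => hK m (by rw [le_abs]; omega)) (fun m hm => hK m (by rw [le_abs]; push_cast at hm; omega))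
  have hval : padicFourierInv (fun y : ℚ_[p] => g ‖y‖) x =
      ∑ i ∈ Finset.range (A + (A + 1)), (g ((p : ℝ) ^ ((A : ℤ) - n - i)) -
        g ((p : ℝ) ^ ((A : ℤ) - n - i + 1))) *
        (if ‖x‖ * (p : ℝ) ^ ((A : ℤ) - n - i) ≤ 1 then ((p : ℝ) ^ ((A : ℤ) - n - i) : ℝ) else 0) := by
    have hmul : ∀ (r : ℝ) (y : ℚ_[p]), (padicChar p (x * y) : ℂ) *
        (Metric.closedBall (0 : ℚ_[p]) r).indicator 1 y =
        (Metric.closedBall (0 : ℚ_[p]) r).indicator (fun y => (padicChar p (x * y) : ℂ)) y := by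
      intro r y
      by_cases hy : y ∈ Metric.closedBall (0 : ℚ_[p]) r
      · simp [indicator_of_mem hy]
      · simp [indicator_of_notMem hy]
    unfold padicFourierInv
    simp only [e, Finset.mul_sum, mul_left_comm _ (g _ - g _), hmul]
    rw [integral_finsetSum]
    · refine Finset.sum_congr rfl fun i _ => ?_
      rw [integral_const_mul, integral_indicator Metric.isClosed_closedBall.measurableSet,
        setIntegral_padicChar]
    · intro i _
      refine Integrable.const_mul ((integrable_indicator_iff
        Metric.isClosed_closedBall.measurableSet).2 ?_) _
      refine ContinuousOn.integrableOn_compact (isCompact_closedBall _ _) ?_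
      exact (continuous_subtype_val.comp
        (continuous_padicChar.comp (continuous_const.mul continuous_id))).continuousOn
  have hcond : ∀ m : ℤ, ‖x‖ * (p : ℝ) ^ m ≤ 1 ↔ n + m ≤ 0 := by
    intro m
    rw [hx, ← zpow_add₀ hp0.ne', zpow_le_one_iff_right₀ hp1]
  rw [hval, Finset.sum_range_add, Finset.sum_eq_zero, zero_add]
  · convert hasSum_sum_of_ne_finset_zero (L := .unconditional ℕ) (s := Finset.range (A + 1)) ?_
      using 1
    · refine Finset.sum_congr rfl fun j _ => ?_
      rw [if_pos ((hcond _).2 (by push_cast; omega)), mul_comm]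
      have : (A : ℤ) - n - ((A + j : ℕ) : ℤ) = -n - j := by push_cast; ring
      rw [this]
    · intro j hj
      rw [Finset.mem_range, not_lt] at hj
      rw [hK _ (by rw [le_abs]; omega), hK _ (by rw [le_abs]; omega), sub_zero, mul_zero]
  · intro i hi
    rw [Finset.mem_range] at hi
    rw [if_neg (mt (hcond _).1 (by omega)), ofReal_zero, mul_zero]

/-! ### The inversion formula at the finite places -/

theorem zpow_cpow (m : ℤ) (w : ℂ) :
    (((p : ℝ) ^ m : ℝ) : ℂ) ^ w = ((p : ℂ) ^ w) ^ m := by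
  have hp0 : (0 : ℝ) < p := by exact_mod_cast hp.out.pos
  have h1 : (((p : ℝ) ^ m : ℝ) : ℂ) ≠ 0 := by exact_mod_cast (zpow_pos hp0 m).ne'
  have h2 : (p : ℂ) ≠ 0 := by exact_mod_cast hp.out.ne_zero
  rw [cpow_def_of_ne_zero h1, cpow_def_of_ne_zero h2, ← ofReal_log (by positivity), Real.log_zpow,
    ← Complex.exp_int_mul, ← natCast_log]
  push_cast
  ring_nf

/-- `|x|^(s - 1) / Γ_p(s)` in terms of `p^s`, for `|x| = p^n`. -/
theorem zpow_cpow_div_tateGammaPadic (n : ℤ) (s : ℂ) :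
    (((p : ℝ) ^ n : ℝ) : ℂ) ^ (s - 1) / tateGammaPadic p s =
      ((p : ℂ) ^ s / p) ^ n * (1 - ((p : ℂ) ^ s)⁻¹) / (1 - (p : ℂ) ^ s / p) := by
  have h2 : (p : ℂ) ≠ 0 := by exact_mod_cast hp.out.ne_zero
  rw [zpow_cpow, tateGammaPadic, neg_add_eq_sub, cpow_sub _ _ h2, cpow_one, cpow_neg, div_div_eq_mul_div]

theorem norm_natCast_cpow_div_lt_one {s : ℂ} (hs1 : s.re < 1) : ‖(p : ℂ) ^ s / p‖ < 1 := by
  have hp1 : (1 : ℝ) < p := by exact_mod_cast hp.out.one_lt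
  rw [norm_div, norm_natCast, norm_natCast_cpow_of_pos hp.out.pos, div_lt_one (by linarith)]
  simpa using Real.rpow_lt_rpow_of_exponent_lt hp1 hs1

/-- The `j`-th term of the expansion of `h |x|^(s - 1) / Γ_p(s)`, for `|x| = p^n`: on the left
as it appears in the inversion formula, on the right as a term of a geometric series. -/
theorem term_eq_geometric (h : ℂ) (n : ℤ) (s : ℂ) (j : ℕ) :
    ((p : ℝ) ^ (-n - j) : ℝ) *
      ((((p : ℝ) ^ (-n - j) : ℝ) : ℂ) ^ (-s) • h - (((p : ℝ) ^ (-n - j + 1) : ℝ) : ℂ) ^ (-s) • h) =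
      h * (((p : ℂ) ^ s / p) ^ n * (1 - ((p : ℂ) ^ s)⁻¹)) * ((p : ℂ) ^ s / p) ^ j := by
  have h2 : (p : ℂ) ≠ 0 := by exact_mod_cast hp.out.ne_zero
  have ha : (p : ℂ) ^ s ≠ 0 := by simp [cpow_eq_zero_iff, h2]
  have hz : (p : ℂ) ^ s / p ≠ 0 := div_ne_zero ha h2
  rw [zpow_cpow, zpow_cpow, cpow_neg, ← zpow_natCast, zpow_add₀ (inv_ne_zero ha), zpow_one]
  have e : (((p : ℝ) ^ (-n - j : ℤ) : ℝ) : ℂ) * (((p : ℂ) ^ s)⁻¹) ^ (-n - j : ℤ) =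
      ((p : ℂ) ^ s / p) ^ n * ((p : ℂ) ^ s / p) ^ (j : ℤ) := by
    rw [← zpow_add₀ hz]
    push_cast
    rw [← mul_zpow, show -n - (j : ℤ) = -(n + j) by ring, zpow_neg, ← inv_zpow, mul_inv, inv_inv,
      div_eq_mul_inv, mul_comm]
  simp only [smul_eq_mul]
  linear_combination (h * (1 - ((p : ℂ) ^ s)⁻¹)) * e

/-- The geometric series expansion of `1 / Γ_p(s)` for `Re s < 1`, multiplied by
`h |x|^(s - 1)`. -/
theorem hasSum_div_tateGammaPadic (h : ℂ) (n : ℤ) {s : ℂ} (hs1 : s.re < 1) :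
    HasSum (fun j : ℕ => ((p : ℝ) ^ (-n - j) : ℝ) *
      ((((p : ℝ) ^ (-n - j) : ℝ) : ℂ) ^ (-s) • h - (((p : ℝ) ^ (-n - j + 1) : ℝ) : ℂ) ^ (-s) • h))
      (h * (((p : ℝ) ^ n : ℝ) : ℂ) ^ (s - 1) / tateGammaPadic p s) := by
  simp only [term_eq_geometric]
  rw [mul_div_assoc, zpow_cpow_div_tateGammaPadic, ← mul_div_assoc]
  exact (hasSum_geometric_of_norm_lt_one (norm_natCast_cpow_div_lt_one hs1)).mul_left _

theorem mellin_inversion_finite_place {g : ℝ → ℂ} (hg : ContDiff ℝ ∞ g)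
    (hgc : HasCompactSupport g)
    (hgs : tsupport g ⊆ Ioi 0) {c : ℝ} (hc0 : 0 < c) (hc1 : c < 1) {x : ℚ_[p]} (hx : x ≠ 0) :
    VerticalIntegrable (fun s => mellin g s * (‖x‖ : ℂ) ^ (s - 1) / tateGammaPadic p s) c ∧
      padicFourierInv (fun y : ℚ_[p] => g ‖y‖) x = 1 / (2 * Real.pi * I) * lineIntegral c
        (fun s => mellin g s * (‖x‖ : ℂ) ^ (s - 1) / tateGammaPadic p s) := by
  have hp1 : (1 : ℝ) < p := by exact_mod_cast hp.out.one_lt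
  have hp0 : (0 : ℝ) < p := by linarith
  have hpC : (p : ℂ) ≠ 0 := by exact_mod_cast hp.out.ne_zero
  obtain ⟨n, hn⟩ : ∃ n : ℤ, ‖x‖ = (p : ℝ) ^ n := ⟨_, Padic.norm_eq_zpow_neg_valuation hx⟩
  rw [hn]
  set φ : 𝓢(ℝ, ℂ) := hgc.toSchwartzMap hg
  have hφg : ∀ y, φ y = g y := fun _ => rfl
  have hV : Integrable (fun t : ℝ => mellin g (c + t * I)) :=
    verticalIntegrable_mellin_schwartz φ hc0
  have hre : ∀ t : ℝ, (c + t * I : ℂ).re = c := fun t => by simp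
  have hna : ∀ t : ℝ, ‖(p : ℂ) ^ (c + t * I : ℂ)‖ = (p : ℝ) ^ c := fun t => by
    rw [norm_natCast_cpow_of_pos hp.out.pos, hre]
  set r : ℝ := (p : ℝ) ^ c / p
  have hnz : ∀ t : ℝ, ‖(p : ℂ) ^ (c + t * I : ℂ) / p‖ = r := fun t => by
    rw [norm_div, hna, norm_natCast]
  have hr0 : 0 ≤ r := by positivity
  have hr1 : r < 1 := by
    rw [← hnz 0]
    exact norm_natCast_cpow_div_lt_one (by rw [hre]; exact hc1)
  set C : ℝ := r ^ n * (1 + ((p : ℝ) ^ c)⁻¹)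
  have hbound : ∀ t : ℝ, ‖((p : ℂ) ^ (c + t * I : ℂ) / p) ^ n *
      (1 - ((p : ℂ) ^ (c + t * I : ℂ))⁻¹)‖ ≤ C := fun t => by
    rw [norm_mul, norm_zpow, hnz]
    refine mul_le_mul_of_nonneg_left ((norm_sub_le _ _).trans_eq ?_) (by positivity)
    rw [norm_one, norm_inv, hna]
  have hVI : VerticalIntegrable (fun s => mellin g s * (((p : ℝ) ^ n : ℝ) : ℂ) ^ (s - 1) /
      tateGammaPadic p s) c := by
    refine (Integrable.mul_bdd (c := C * (1 - r)⁻¹) (g := fun t : ℝ =>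
      ((p : ℂ) ^ (c + t * I : ℂ) / p) ^ n * (1 - ((p : ℂ) ^ (c + t * I : ℂ))⁻¹) /
        (1 - (p : ℂ) ^ (c + t * I : ℂ) / p)) hV (Continuous.aestronglyMeasurable ?_)
      (Eventually.of_forall fun t => ?_)).congr (Eventually.of_forall fun t => by
        simp only [mul_div_assoc (mellin g _), zpow_cpow_div_tateGammaPadic])
    · have ha : Continuous fun t : ℝ => (p : ℂ) ^ (c + t * I : ℂ) :=
        Continuous.const_cpow (by fun_prop) (Or.inl hpC)
      have ha0 : ∀ t : ℝ, (p : ℂ) ^ (c + t * I : ℂ) ≠ 0 := fun t => by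
        simp [cpow_eq_zero_iff, hpC]
      have hz : Continuous fun t : ℝ => (p : ℂ) ^ (c + t * I : ℂ) / p := ha.div_const _
      refine Continuous.div₀ ((hz.zpow₀ n fun t => Or.inl (div_ne_zero (ha0 t) hpC)).mul
        (continuous_const.sub (ha.inv₀ ha0))) (continuous_const.sub hz) fun t h => ?_
      have := hnz t
      rw [← sub_eq_zero.1 h, norm_one] at this
      linarith
    · rw [norm_div, div_eq_mul_inv]
      have h1 : 1 - r ≤ ‖1 - (p : ℂ) ^ (c + t * I : ℂ) / p‖ := by
        have := norm_sub_norm_le 1 ((p : ℂ) ^ (c + t * I : ℂ) / p)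
        rwa [norm_one, hnz] at this
      exact mul_le_mul (hbound t) (inv_anti₀ (by linarith) h1) (by positivity) (by positivity)
  refine ⟨hVI, ?_⟩
  have hinv : ∀ m : ℤ, _ := fun m => integral_cpow_smul_mellin_schwartz φ hc0 (zpow_pos hp0 m)
  -- Integrate the geometric series for `1 / Γ_p` term by term.
  have hsum := hasSum_integral_of_dominated_convergence (μ := volume)
    (F := fun (j : ℕ) (t : ℝ) => (((p : ℝ) ^ (-n - j) : ℝ) : ℂ) *
      ((((p : ℝ) ^ (-n - j) : ℝ) : ℂ) ^ (-(c + t * I : ℂ)) • mellin φ (c + t * I) -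
        (((p : ℝ) ^ (-n - j + 1) : ℝ) : ℂ) ^ (-(c + t * I : ℂ)) • mellin φ (c + t * I)))
    (f := fun t : ℝ => mellin φ (c + t * I) * (((p : ℝ) ^ n : ℝ) : ℂ) ^ ((c + t * I : ℂ) - 1) /
      tateGammaPadic p (c + t * I))
    (fun (j : ℕ) (t : ℝ) => ‖mellin φ (c + t * I)‖ * C * r ^ j)
    (fun j => (((hinv _).1.sub (hinv _).1).const_mul _).aestronglyMeasurable)
    (fun j => Eventually.of_forall fun t => by
      rw [term_eq_geometric, norm_mul, norm_mul, norm_pow, hnz]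
      gcongr
      exact hbound t)
    (Eventually.of_forall fun t => (summable_geometric_of_lt_one hr0 hr1).mul_left _)
    (by
      simp only [tsum_mul_left]
      exact (hV.norm.mul_const C).mul_const _)
    (Eventually.of_forall fun t => hasSum_div_tateGammaPadic _ n (by rw [hre]; exact hc1))
  have hterm : ∀ j : ℕ, ∫ t : ℝ, (((p : ℝ) ^ (-n - j) : ℝ) : ℂ) *
      ((((p : ℝ) ^ (-n - j) : ℝ) : ℂ) ^ (-(c + t * I : ℂ)) • mellin φ (c + t * I) -
        (((p : ℝ) ^ (-n - j + 1) : ℝ) : ℂ) ^ (-(c + t * I : ℂ)) • mellin φ (c + t * I)) =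
      2 * Real.pi * ((((p : ℝ) ^ (-n - j) : ℝ) : ℂ) *
        (g ((p : ℝ) ^ (-n - j)) - g ((p : ℝ) ^ (-n - j + 1)))) := fun j => by
    rw [integral_const_mul, integral_sub (hinv _).1 (hinv _).1, (hinv _).2, (hinv _).2, hφg, hφg]
    ring
  simp only [hterm] at hsum
  have hL := hsum.unique ((hasSum_padicFourierInv_radial hgc hgs hn).mul_left (2 * Real.pi : ℂ))
  rw [lineIntegral, integral_mul_const]
  change _ = 1 / (2 * Real.pi * I) * ((∫ t : ℝ, mellin φ (c + t * I) *
    (((p : ℝ) ^ n : ℝ) : ℂ) ^ ((c + t * I : ℂ) - 1) / tateGammaPadic p (c + t * I)) * I)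
  rw [hL]
  have : (Real.pi : ℂ) ≠ 0 := by exact_mod_cast Real.pi_ne_zero
  field_simp

end Padic

end MellinFourier

end

theorem mainTheorem10 (g : ℝ → ℂ) (hg : ContDiff ℝ ∞ g) (hgc : HasCompactSupport g)
    (hgs : tsupport g ⊆ Set.Ioi 0) (c : ℝ) (hc0 : 0 < c) (hc1 : c < 1) :
    -- the real place
    (Integrable (fun y : ℝ => g |y|) ∧
      ∀ x : ℝ, x ≠ 0 →
        VerticalIntegrable
          (fun s => mellin g s * ((|x| : ℝ) : ℂ) ^ (s - 1) / MellinFourier.tateGammaReal s) c ∧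
        𝓕⁻ (fun y : ℝ => g |y|) x =
          1 / (2 * Real.pi * I) * MellinFourier.lineIntegral c
            (fun s => mellin g s * ((|x| : ℝ) : ℂ) ^ (s - 1) / MellinFourier.tateGammaReal s)) ∧
    -- the finite places
    ∀ (p : ℕ) [Fact p.Prime],
      Integrable (fun y : ℚ_[p] => g ‖y‖) (MellinFourier.padicHaar p) ∧
      ∀ x : ℚ_[p], x ≠ 0 →
        VerticalIntegrable
          (fun s => mellin g s * (‖x‖ : ℂ) ^ (s - 1) / MellinFourier.tateGammaPadic p s) c ∧
        MellinFourier.padicFourierInv (fun y : ℚ_[p] => g ‖y‖) x =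
          1 / (2 * Real.pi * I) * MellinFourier.lineIntegral c
            (fun s => mellin g s * (‖x‖ : ℂ) ^ (s - 1) / MellinFourier.tateGammaPadic p s) := by
  
  refine ⟨⟨?_, fun x hx => MellinFourier.mellin_inversion_real_place hg hgc hgs hc0 hc1 hx⟩, fun p _ =>
    ⟨MellinFourier.integrable_radial hgc hgs, fun x hx => MellinFourier.mellin_inversion_finite_place hg hgc hgs hc0 hc1 hx⟩⟩
  obtain ⟨φ, hφ⟩ := MellinFourier.exists_schwartz_eq_comp_abs hg hgc hgs
  exact φ.integrable.congr (Filter.Eventually.of_forall hφ)
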